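/- Let $R$ be a finite associative ring with identity which is Frobenius, i.e. $R/\mathrm{Rad}(R)\cong \mathrm{Soc}(R_R)$ as right $R$-modules and $R/\mathrm{Rad}(R)\cong \mathrm{Soc}({}_RR)$ as left $R$-modules, where $\mathrm{Rad}$ is the Jacobson radical and $\mathrm{Soc}$ the socle. Let $m,n,d\ge 0$ be integers, $E=\{1,\dots,n\}$, and let $E_d$ be the set of $d$-element subsets of $E$. Let $f=\sum_{Z\in E_d} f(Z)\,Z$ be an element of $\mathrm{Harm}_d(n)$, the kernel of the linear map on the real vector space $\mathbb{R}E_d$ with basis $E_d$ that sends each $Z\in E_d$ to $\sum_{Y\subseteq Z,\ |Y|=d-1} Y$. For $X\subseteq E$ put $\widetilde f(X)=\sum_{Z\in E_d,\ Z\subseteq X} f(Z)$. For a left or right $R$-linear code $C$ of length $n$ (a left or right $R$-submodule of $R^n$) and $X\subseteq E$, let $A_C^{[m]}(X)$ be the number of $m$-tuples $(u_1,\dots,u_m)\in C^m$ with $\mathrm{supp}(u_1)\cup\dots\cup\mathrm{supp}(u_m)=X$, where $\mathrm{supp}(u)=\{i\in E: u_i\ne 0\}$, and define the $m$-tuple harmonic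 weight enumerator $$W^{[m]}_{C,f}(x,y)=\sum_{X\subseteq E}\widetilde f(X)\,A_C^{[m]}(X)\,x^{n-|X|}y^{|X|}\in\mathbb{R}[x,y].$$ Let $C$ be a left $R$-linear code of length $n$, with right dual code $C^\perp=\{u\in R^n : \sum_{i=1}^n v_iu_i=0 \text{ for all } v\in C\}$. Then there are (necessarily unique) polynomials $Z^{[m]}_{C,f},Z^{[m]}_{C^\perp,f}\in\mathbb{R}[x,y]$ with $$W^{[m]}_{C,f}=(xy)^dZ^{[m]}_{C,f},\qquad W^{[m]}_{C^\perp,f}=(xy)^dZ^{[m]}_{C^\perp,f},$$ both are homogeneous of degree $n-2d$ (for $n<2d$ this means that both are zero), and $$Z^{[m]}_{C^\perp,f}(x,y)=(-1)^d\,\frac{(|R|^m)^d}{|C|^m}\;Z^{[m]}_{C,f}\bigl(x+(|R|^m-1)y,\;x-y\bigr).$$ -/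

import Mathlib

namespace HarmonicCodes

noncomputable section

/-! ### Discrete harmonic functions -/

/-- The set `E_d` of subsets of size `d` of `E = Fin n`. -/
abbrev Layer (n d : ℕ) : Type := {Z : Finset (Fin n) // Z.card = d}

/-- The set of subsets of size `d - 1` of `E = Fin n`; it is empty for `d = 0`. -/
abbrev LowerLayer (n d : ℕ) : Type := {Y : Finset (Fin n) // Y.card + 1 = d}

/-- The differentiation on the real vector space with basis `E_d`: the linear map that sends
`Z` to the sum of all subsets `Y` of `Z` of size `d - 1`. -/
def gamma (n d : ℕ) : (Layer n d →₀ ℝ) →ₗ[ℝ] (LowerLayer n d →₀ ℝ) :=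
  Finsupp.linearCombination ℝ fun Z : Layer n d =>
    ∑ Y : LowerLayer n d with Y.1 ⊆ Z.1, Finsupp.single Y (1 : ℝ)

/-- The space `Harm_d(n)` of harmonic functions of degree `d`. -/
def Harm (n d : ℕ) : Submodule ℝ (Layer n d →₀ ℝ) := LinearMap.ker (gamma n d)

/-- The extension of `f` to all subsets of `E`. -/
def tilde {n d : ℕ} (f : Layer n d →₀ ℝ) (X : Finset (Fin n)) : ℝ :=
  ∑ Z : Layer n d with Z.1 ⊆ X, f Z

/-! ### Frobenius rings -/

/-- The socle of a module: the sum of its simple submodules. -/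
def socle (S M : Type*) [Ring S] [AddCommGroup M] [Module S M] : Submodule S M :=
  sSup {N : Submodule S M | IsSimpleModule S N}

/-- The Jacobson radical of `R`, seen as a right ideal. -/
def rightRad (R : Type*) [Ring R] : Submodule Rᵐᵒᵖ R where
  carrier := {a | a ∈ Ring.jacobson R}
  add_mem' := fun ha hb => (Ring.jacobson R).add_mem ha hb
  zero_mem' := (Ring.jacobson R).zero_mem
  smul_mem' := fun c _ ha => Ideal.mul_mem_right c.unop (Ring.jacobson R) ha

/-- The Frobenius property: `R / Rad R` is isomorphic to the socle of `R`, both as right and as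
left modules. (Right modules are modules over `Rᵐᵒᵖ`.) -/
structure IsFrobeniusRing (R : Type*) [Ring R] : Prop where
  right : Nonempty ((R ⧸ rightRad R) ≃ₗ[Rᵐᵒᵖ] socle Rᵐᵒᵖ R)
  left : Nonempty ((R ⧸ Ring.jacobson R) ≃ₗ[R] socle R R)

/-! ### Codes -/

/-- The right dual code of a left linear code. -/
def rightDual {R : Type*} [Ring R] {n : ℕ} (D : Submodule R (Fin n → R)) :
    Submodule Rᵐᵒᵖ (Fin n → R) where
  carrier := {u | ∀ v ∈ D, v ⬝ᵥ u = 0}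
  add_mem' := fun {a b} ha hb v hv => by
    rw [dotProduct_add, ha v hv, hb v hv, add_zero]
  zero_mem' := fun v _ => dotProduct_zero v
  smul_mem' := fun c u hu v hv => by
    rw [dotProduct_smul, hu v hv, smul_zero]

open Classical in
/-- The support of a vector. -/
def supp {R : Type*} [Ring R] {n : ℕ} (u : Fin n → R) : Finset (Fin n) :=
  {i | u i ≠ 0}

/-- The number of `m`-tuples of words of `C` whose supports have union `X`. -/
def tupleCount {R : Type*} [Ring R] {n : ℕ} (m : ℕ) (C : Set (Fin n → R))
    (X : Finset (Fin n)) : ℕ :=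
  Nat.card {u : Fin m → C // (Finset.univ.biUnion fun i => supp (u i).1) = X}

/-- The `m`-tuple harmonic weight enumerator of `C` associated to `f`, a polynomial in the
variables `x = X 0` and `y = X 1`. It depends only on the set of words of `C`, and is used for
left and for right linear codes. -/
def harmonicWeightEnumerator {R : Type*} [Ring R] {n d : ℕ} (m : ℕ) (C : Set (Fin n → R))
    (f : Layer n d →₀ ℝ) : MvPolynomial (Fin 2) ℝ :=
  ∑ X : Finset (Fin n), MvPolynomial.C (tilde f X * (tupleCount m C X : ℝ)) *
    MvPolynomial.X 0 ^ (Xᶜ).card * MvPolynomial.X 1 ^ X.card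

end

end HarmonicCodes

namespace HarmonicCodes

/-! With `B J` the number of words of the code supported in `J`, inclusion–exclusion on supports
suggests the quotient `∑ J, B J ^ m * f̃(J) * y ^ (|J| - d) * (x - y) ^ (n - |J| - d)`;
`sum_superset_mul_tilde_smul` shows that `(x * y) ^ d` times it is the weight enumerator. The
substitution `x ↦ x + (q - 1) y`, `y ↦ x - y`, with `q = |R| ^ m`, sends `x - y` to `q y` and `y` to
`x - y`, so it exchanges the roles of `J` and `Jᶜ`. Duality makes the same exchange: `|C| * B^⊥ J =
|R| ^ |J| * B Jᶜ` (`card_mul_shortenedCard_rightDual`, by a generating character of `R`) and `f̃(Jᶜ)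
= (-1) ^ d * f̃(J)` (`tilde_compl`). -/

/-! ### Generating characters of Frobenius rings -/

/-- A semisimple ring has a character whose kernel contains no nonzero left ideal. -/
theorem exists_generating_of_isSemisimpleRing (S : Type*) [Ring S] [IsSemisimpleRing S] :
    ∃ φ : CharacterModule S, ∀ a : S, (∀ s : S, φ (s * a) = 0) → a = 0 := by
  classical
  obtain ⟨n, D, k, _, _, -, ⟨e⟩⟩ :=
    IsSemisimpleRing.exists_algEquiv_pi_matrix_divisionRing ℤ S
  have hc (i : Fin n) : ∃ c : CharacterModule (D i), c 1 ≠ 0 :=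
    CharacterModule.exists_character_apply_ne_zero_of_ne_zero one_ne_zero
  choose c hc using hc
  let φ : S →+ AddCircle (1 : ℚ) :=
    ∑ i, (c i : D i →+ AddCircle (1 : ℚ)).comp ((Matrix.traceAddMonoidHom (Fin (k i)) (D i)).comp
      ((Pi.evalAddMonoidHom (fun i => Matrix (Fin (k i)) (Fin (k i)) (D i)) i).comp
        (e : S →+ Π i, Matrix (Fin (k i)) (Fin (k i)) (D i))))
  have hφ (s : S) : φ s = ∑ i, c i (e s i).trace := by
    simp only [φ, AddMonoidHom.finsetSum_apply]
    rfl
  refine ⟨φ, fun a ha => ?_⟩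
  rw [← map_eq_zero_iff e e.injective]
  ext i p q
  by_contra hne
  refine hc i ?_
  -- Multiplied by `a`, this element has trace `1` in block `i` and `0` in the other blocks.
  have h := ha (e.symm (Pi.single i (Matrix.single q p (e a i p q)⁻¹)))
  have h' := (hφ _).symm.trans h
  rw [Finset.sum_eq_single i] at h'
  · simpa [Matrix.trace_single_mul, inv_mul_cancel₀ hne] using h'
  · intro j _ hj
    simp [Pi.single_eq_of_ne hj]
  · simp

/-- A finite Frobenius ring has a character whose kernel contains no nonzero left ideal. -/
theorem IsFrobeniusRing.exists_generating {R : Type*} [Ring R] [Finite R]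
    (hR : IsFrobeniusRing R) :
    ∃ φ : CharacterModule R, ∀ a : R, (∀ r : R, φ (r * a) = 0) → a = 0 := by
  obtain ⟨e⟩ := hR.left
  obtain ⟨ψ, hψ⟩ := exists_generating_of_isSemisimpleRing (R ⧸ Ring.jacobson R)
  let ψ' : CharacterModule (socle R R) := (ψ : _ →+ _).comp (e.symm : _ →+ _)
  -- `ℚ/ℤ` is injective, so the character of the socle extends to `R`; a nonzero left ideal in its
  -- kernel would contain a simple one, which lies in the socle.
  obtain ⟨φ, hφ⟩ := CharacterModule.dual_surjective_of_injective (R := ℤ)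
    ((socle R R).subtype.restrictScalars ℤ) Subtype.val_injective ψ'
  have hφ' (x : socle R R) : φ x.1 = ψ (e.symm x) := DFunLike.congr_fun hφ x
  refine ⟨φ, fun a ha => ?_⟩
  by_contra hne
  have hI : Submodule.span R {a} ≠ ⊥ := by simpa using hne
  obtain ⟨N, hN, hle⟩ := (eq_bot_or_exists_atom_le (Submodule.span R {a})).resolve_left hI
  have hsimple : IsSimpleModule R N := isSimpleModule_iff_isAtom.2 hN
  have hsoc : N ≤ socle R R := le_sSup hsimple
  obtain ⟨b, hb, hb0⟩ := N.ne_bot_iff.1 hN.1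
  have hzero (r : R) : φ (r * b) = 0 := by
    obtain ⟨s, rfl⟩ := Submodule.mem_span_singleton.1 (hle hb)
    rw [smul_eq_mul, ← mul_assoc]
    exact ha _
  refine hb0 ?_
  have h0 : e.symm ⟨b, hsoc hb⟩ = 0 := by
    refine hψ _ fun s => ?_
    obtain ⟨r, rfl⟩ := Ideal.Quotient.mk_surjective s
    have h1 : Ideal.Quotient.mk (Ring.jacobson R) r * e.symm ⟨b, hsoc hb⟩
        = e.symm (r • ⟨b, hsoc hb⟩) := by
      rw [map_smul]; rfl
    rw [h1, ← hφ']
    exact hzero r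
  simpa using h0

/-- The embedding of `ℚ/ℤ` in the circle group, as an additive character. -/
theorem exists_injective_addChar : ∃ χ : AddChar (AddCircle (1 : ℚ)) ℂ, ∀ x, χ x = 1 → x = 0 := by
  let g : AddCircle (1 : ℚ) →+ AddCircle (1 : ℝ) :=
    QuotientAddGroup.map _ _ (Rat.castHom ℝ).toAddMonoidHom (by
      rintro _ ⟨n, rfl⟩
      exact ⟨n, by simp⟩)
  refine ⟨⟨fun x => ((g x).toCircle : ℂ), by simp, fun a b => by
    simp [AddCircle.toCircle_add]⟩, fun x hx => ?_⟩
  have h1 : g x = 0 := by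
    refine AddCircle.injective_toCircle one_ne_zero ?_
    rw [AddCircle.toCircle_zero]
    exact Subtype.ext hx
  obtain ⟨q, rfl⟩ := QuotientAddGroup.mk_surjective x
  have h2 : ((q : ℝ) : AddCircle (1 : ℝ)) = 0 := h1
  rw [AddCircle.coe_eq_zero_iff] at h2
  obtain ⟨n, hn⟩ := h2
  refine (AddCircle.coe_eq_zero_iff (1 : ℚ)).2 ⟨n, ?_⟩
  have : ((n : ℚ) : ℝ) = (q : ℝ) := by simpa using hn
  simpa using (Rat.cast_injective this)

/-- A finite Frobenius ring has a complex character whose kernel contains neither a nonzero left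
ideal nor a nonzero right ideal. -/
theorem IsFrobeniusRing.exists_addChar {R : Type*} [Ring R] [Finite R]
    (hR : IsFrobeniusRing R) :
    ∃ χ : AddChar R ℂ, (∀ a : R, (∀ r : R, χ (r * a) = 1) → a = 0) ∧
      ∀ a : R, (∀ r : R, χ (a * r) = 1) → a = 0 := by
  obtain ⟨φ, hφ⟩ := hR.exists_generating
  obtain ⟨ι, hι⟩ := exists_injective_addChar
  let χ : AddChar R ℂ := ι.compAddMonoidHom (φ : R →+ AddCircle (1 : ℚ))
  have hχ (a : R) (ha : ∀ r : R, χ (r * a) = 1) : a = 0 := hφ a fun r => hι _ (ha r)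
  refine ⟨χ, hχ, fun a ha => ?_⟩
  -- Left nondegeneracy makes `T` injective, and counting makes every character a translate of `χ`;
  -- characters separate points, which gives the right-hand condition.
  let T : R → AddChar R ℂ := fun r => χ.compAddMonoidHom (AddMonoidHom.mulRight r)
  have hT (r x : R) : T r x = χ (x * r) := rfl
  have hinj : Function.Injective T := by
    intro r s hrs
    refine sub_eq_zero.1 (hχ _ fun x => ?_)
    have h := DFunLike.congr_fun hrs x
    rw [hT, hT] at h
    rw [mul_sub, AddChar.map_sub_eq_div, h, div_self]
    exact (χ.val_isUnit _).ne_zero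
  have hbij : Function.Bijective T := by
    cases nonempty_fintype R
    exact (Fintype.bijective_iff_injective_and_card _).2 ⟨hinj, AddChar.card_eq.symm⟩
  refine AddChar.forall_apply_eq_zero.1 fun ψ => ?_
  obtain ⟨r, rfl⟩ := hbij.2 ψ
  exact ha r

/-! ### Cardinalities of shortened codes -/

/-- The number of words of `C` with support in `J`. -/
noncomputable def shortenedCard {R : Type*} [Ring R] {n : ℕ} (C : Set (Fin n → R))
    (J : Finset (Fin n)) : ℕ :=
  Nat.card {u : Fin n → R // u ∈ C ∧ supp u ⊆ J}

theorem supp_subset_iff {R : Type*} [Ring R] {n : ℕ} (u : Fin n → R) (J : Finset (Fin n)) :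
    supp u ⊆ J ↔ ∀ i ∉ J, u i = 0 := by
  classical
  simp only [supp, Finset.subset_iff, Finset.mem_filter, Finset.mem_univ, true_and]
  exact forall_congr' fun i => not_imp_comm

/-- The additive group of vectors with support in `J`. -/
def suppSubgroup (R : Type*) [Ring R] {n : ℕ} (J : Finset (Fin n)) : AddSubgroup (Fin n → R) where
  carrier := {u | ∀ i ∉ J, u i = 0}
  add_mem' := fun ha hb i hi => by simp [ha i hi, hb i hi]
  zero_mem' := fun _ _ => rfl
  neg_mem' := fun ha i hi => by simp [ha i hi]

theorem card_suppSubgroup (R : Type*) [Ring R] {n : ℕ} (J : Finset (Fin n)) :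
    Nat.card (suppSubgroup R J) = Nat.card R ^ J.card := by
  classical
  let e : suppSubgroup R J ≃ (J → R) :=
    { toFun := fun u i => u.1 i
      invFun := fun v => ⟨fun i => if h : i ∈ J then v ⟨i, h⟩ else 0, fun i hi => by simp [hi]⟩
      left_inv := fun u => by
        ext i
        by_cases h : i ∈ J
        · simp [h]
        · simp [h, u.2 i h]
      right_inv := fun v => by
        ext i
        simp }
  rw [Nat.card_congr e, Nat.card_fun]
  simp

/-- The MacWilliams identity for the shortened codes of a code over a Frobenius ring. -/
theorem card_mul_shortenedCard_rightDual {R : Type*} [Ring R] [Finite R] (hR : IsFrobeniusRing R)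
    {n : ℕ} (D : Submodule R (Fin n → R)) (J : Finset (Fin n)) :
    Nat.card D * shortenedCard (rightDual D : Set (Fin n → R)) J =
      Nat.card R ^ J.card * shortenedCard (D : Set (Fin n → R)) Jᶜ := by
  classical
  cases nonempty_fintype R
  have := Fintype.ofFinite D
  have := Fintype.ofFinite (suppSubgroup R J)
  obtain ⟨χ, hl, hr⟩ := hR.exists_addChar
  -- Sum `χ (v ⬝ᵥ u)` over `v ∈ D` and `u` supported in `J` in both orders. The sum over `v` uses
  -- the condition on left ideals, the sum over `u` that on right ideals.
  have hrow (u : Fin n → R) :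
      ∑ v : D, χ (v.1 ⬝ᵥ u) = if u ∈ rightDual D then (Nat.card D : ℂ) else 0 := by
    let ψ : AddChar D ℂ := χ.compAddMonoidHom
      ⟨⟨fun v => v.1 ⬝ᵥ u, by simp⟩, fun a b => by simp [add_dotProduct]⟩
    have hψ : ψ = 0 ↔ u ∈ rightDual D := by
      constructor
      · intro h v hv
        refine hl _ fun r => ?_
        have := DFunLike.congr_fun h ⟨r • v, D.smul_mem r hv⟩
        simpa [ψ, smul_dotProduct] using this
      · intro h
        ext v
        have : v.1 ⬝ᵥ u = 0 := h v.1 v.2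
        simp [ψ, this]
    have := AddChar.sum_eq_ite ψ
    simp only [hψ, ← Nat.card_eq_fintype_card] at this
    exact this
  have hcol (v : Fin n → R) :
      ∑ u : suppSubgroup R J, χ (v ⬝ᵥ u.1) =
        if supp v ⊆ Jᶜ then ((Nat.card R ^ J.card : ℕ) : ℂ) else 0 := by
    let ψ : AddChar (suppSubgroup R J) ℂ := χ.compAddMonoidHom
      ⟨⟨fun u => v ⬝ᵥ u.1, by simp⟩, fun a b => by simp [dotProduct_add]⟩
    have hψ : ψ = 0 ↔ supp v ⊆ Jᶜ := by
      rw [supp_subset_iff]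
      constructor
      · intro h i hi
        refine hr _ fun r => ?_
        have hi' : i ∈ J := by simpa using hi
        have := DFunLike.congr_fun h ⟨Pi.single i r, fun j hj => by
          rw [Pi.single_eq_of_ne]; rintro rfl; exact hj hi'⟩
        simpa [ψ] using this
      · intro h
        ext u
        have : v ⬝ᵥ u.1 = 0 := Finset.sum_eq_zero fun i _ => by
          by_cases hi : i ∈ J
          · rw [h i (by simpa using hi), zero_mul]
          · rw [u.2 i hi, mul_zero]
        simp [ψ, this]
    have := AddChar.sum_eq_ite ψ
    simp only [hψ, ← Nat.card_eq_fintype_card, card_suppSubgroup] at this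
    exact this
  have hcomm := Finset.sum_comm (s := (Finset.univ : Finset D))
    (t := (Finset.univ : Finset (suppSubgroup R J))) (f := fun v u => χ (v.1 ⬝ᵥ u.1))
  simp only [hrow, hcol] at hcomm
  rw [← Finset.sum_filter, ← Finset.sum_filter, Finset.sum_const, Finset.sum_const, nsmul_eq_mul,
    nsmul_eq_mul] at hcomm
  have h1 : (Finset.univ.filter fun v : D => supp v.1 ⊆ Jᶜ).card =
      shortenedCard (D : Set (Fin n → R)) Jᶜ := by
    rw [shortenedCard, ← Fintype.card_subtype, ← Nat.card_eq_fintype_card]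
    exact Nat.card_congr (Equiv.subtypeSubtypeEquivSubtypeInter (fun v => v ∈ D)
      fun v => supp v ⊆ Jᶜ)
  have h2 : (Finset.univ.filter fun u : suppSubgroup R J => u.1 ∈ rightDual D).card =
      shortenedCard (rightDual D : Set (Fin n → R)) J := by
    rw [shortenedCard, ← Fintype.card_subtype, ← Nat.card_eq_fintype_card]
    refine Nat.card_congr ((Equiv.subtypeSubtypeEquivSubtypeInter
      (fun u => u ∈ suppSubgroup R J) (fun u => u ∈ rightDual D)).trans
      (Equiv.subtypeEquivRight fun u => ?_))
    rw [supp_subset_iff, and_comm]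
    rfl
  rw [h1, h2] at hcomm
  have : shortenedCard (D : Set (Fin n → R)) Jᶜ * Nat.card R ^ J.card =
      shortenedCard (rightDual D : Set (Fin n → R)) J * Nat.card D := by exact_mod_cast hcomm
  rw [mul_comm, ← this, mul_comm]


/-! ### Discrete harmonic functions -/

section Harmonic

variable {n d : ℕ} {f : Layer n d →₀ ℝ}

theorem gamma_apply (f : Layer n d →₀ ℝ) (Y : LowerLayer n d) :
    gamma n d f Y = ∑ Z : Layer n d with Y.1 ⊆ Z.1, f Z := by
  classical
  rw [gamma, Finsupp.linearCombination_apply, Finsupp.sum_fintype _ _ (by simp),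
    Finsupp.finsetSum_apply, Finset.sum_filter]
  refine Finset.sum_congr rfl fun Z _ => ?_
  simp [Finsupp.single_apply, Finset.sum_ite_eq']

/-- The coefficients of a harmonic function on the sets that contain a given small set sum to
zero. -/
theorem sum_superset_eq_zero (hf : f ∈ Harm n d) {Y : Finset (Fin n)} (hY : Y.card < d) :
    ∑ Z : Layer n d with Y ⊆ Z.1, f Z = 0 := by
  classical
  obtain ⟨k, hk⟩ := Nat.exists_eq_add_of_lt hY
  induction k generalizing Y with
  | zero =>
    have h := DFunLike.congr_fun (LinearMap.mem_ker.1 hf) (⟨Y, by omega⟩ : LowerLayer n d)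
    rwa [gamma_apply] at h
  | succ k ih =>
    -- Enlarge `Y` by one point in all ways: each sum vanishes by induction, and each `Z ⊇ Y` is
    -- counted `|Z \ Y| = k + 2` times.
    have h1 : ∑ e ∈ Yᶜ, ∑ Z : Layer n d with insert e Y ⊆ Z.1, f Z = 0 := by
      refine Finset.sum_eq_zero fun e he => ?_
      have hc := Finset.card_insert_of_notMem (Finset.mem_compl.1 he)
      exact ih (by omega) (by omega)
    have h2 : ∑ e ∈ Yᶜ, ∑ Z : Layer n d with insert e Y ⊆ Z.1, f Z =
        ∑ Z : Layer n d with Y ⊆ Z.1, ((k : ℝ) + 2) * f Z := by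
      rw [Finset.sum_comm' (t' := Finset.univ.filter fun Z : Layer n d => Y ⊆ Z.1)
        (s' := fun Z => Z.1 \ Y)]
      · refine Finset.sum_congr rfl fun Z hZ => ?_
        have hc := Finset.card_sdiff_of_subset (Finset.mem_filter.1 hZ).2
        have hk2 : (Z.1 \ Y).card = k + 2 := by have := Z.2; omega
        rw [Finset.sum_const, hk2, nsmul_eq_mul]
        push_cast
        rfl
      · intro e Z
        simp only [Finset.mem_compl, Finset.mem_filter, Finset.mem_univ, true_and,
          Finset.insert_subset_iff, Finset.mem_sdiff]
        tauto
    rw [h2, ← Finset.mul_sum] at h1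
    exact (mul_eq_zero.1 h1).resolve_left (by positivity)

/-- Expand `a = (a - b) + b` over the subsets `Y` of `Z ∩ J`. Harmonicity kills all `Y` with fewer
than `d` elements, leaving `Y = Z ⊆ J`. -/
theorem sum_smul_pow_mul_pow (hf : f ∈ Harm n d) {A : Type*} [CommRing A] [Algebra ℝ A]
    (J : Finset (Fin n)) (a b : A) :
    ∑ Z : Layer n d, f Z • (a ^ (Z.1 ∩ J).card * b ^ (Z.1 \ J).card) =
      tilde f J • (a - b) ^ d := by
  classical
  have hexp (Z : Layer n d) : a ^ (Z.1 ∩ J).card * b ^ (Z.1 \ J).card =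
      ∑ Y ∈ J.powerset with Y ⊆ Z.1, (a - b) ^ Y.card * b ^ (d - Y.card) := by
    have h1 : J.powerset.filter (fun Y => Y ⊆ Z.1) = (Z.1 ∩ J).powerset := by
      ext Y
      simp only [Finset.mem_filter, Finset.mem_powerset, Finset.subset_inter_iff, and_comm]
    have h2 := Finset.sum_pow_mul_eq_add_pow (a - b) b (Z.1 ∩ J)
    rw [sub_add_cancel] at h2
    rw [h1, ← h2, Finset.sum_mul]
    refine Finset.sum_congr rfl fun Y hY => ?_
    have h3 := Finset.card_le_card (Finset.mem_powerset.1 hY)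
    have h4 := Finset.card_inter_add_card_sdiff Z.1 J
    have h5 := Z.2
    rw [mul_assoc, ← pow_add]
    congr 2
    omega
  have hY (Y : Finset (Fin n)) :
      (∑ Z : Layer n d with Y ⊆ Z.1, f Z) • ((a - b) ^ Y.card * b ^ (d - Y.card)) =
        (∑ Z : Layer n d with Z.1 = Y, f Z) • (a - b) ^ d := by
    have hempty (h : Y.card ≠ d) : (∑ Z : Layer n d with Z.1 = Y, f Z) = 0 := by
      refine Finset.sum_eq_zero fun Z hZ => ?_
      exact absurd ((Finset.mem_filter.1 hZ).2 ▸ Z.2) h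
    rcases lt_trichotomy Y.card d with h | h | h
    · rw [sum_superset_eq_zero hf h, hempty h.ne, zero_smul, zero_smul]
    · have : ∀ Z : Layer n d, Y ⊆ Z.1 ↔ Z.1 = Y := fun Z =>
        ⟨fun hs => (Finset.eq_of_subset_of_card_le hs (by rw [Z.2, h])).symm, fun e => e ▸ subset_rfl⟩
      simp only [this, h, Nat.sub_self, pow_zero, mul_one]
    · rw [hempty h.ne', zero_smul, Finset.sum_eq_zero, zero_smul]
      intro Z hZ
      have := Finset.card_le_card (Finset.mem_filter.1 hZ).2
      have := Z.2
      omega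
  calc ∑ Z : Layer n d, f Z • (a ^ (Z.1 ∩ J).card * b ^ (Z.1 \ J).card)
      = ∑ Y ∈ J.powerset, (∑ Z : Layer n d with Y ⊆ Z.1, f Z) •
          ((a - b) ^ Y.card * b ^ (d - Y.card)) := by
        simp only [hexp, Finset.smul_sum, Finset.sum_smul]
        exact Finset.sum_comm' fun Z Y => by simp [and_comm]
    _ = (∑ Y ∈ J.powerset, ∑ Z : Layer n d with Z.1 = Y, f Z) • (a - b) ^ d := by
        rw [Finset.sum_smul]
        exact Finset.sum_congr rfl fun Y _ => hY Y
    _ = tilde f J • (a - b) ^ d := by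
        congr 1
        rw [tilde, Finset.sum_comm' (t' := Finset.univ.filter fun Z : Layer n d => Z.1 ⊆ J)
          (s' := fun Z => {Z.1})]
        · simp
        · intro Y Z
          simp only [Finset.mem_powerset, Finset.mem_filter, Finset.mem_univ, true_and,
            Finset.mem_singleton]
          constructor
          · rintro ⟨h, rfl⟩; exact ⟨rfl, h⟩
          · rintro ⟨rfl, h⟩; exact ⟨h, rfl⟩

theorem tilde_compl (hf : f ∈ Harm n d) (J : Finset (Fin n)) :
    tilde f Jᶜ = (-1) ^ d * tilde f J := by
  classical
  -- With `a = 0`, `b = 1` only the `Z` disjoint from `J` contribute.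
  have h := sum_smul_pow_mul_pow hf J (0 : ℝ) 1
  simp only [one_pow, mul_one, zero_sub, smul_eq_mul] at h
  rw [mul_comm, ← h, tilde, Finset.sum_filter]
  refine Finset.sum_congr rfl fun Z _ => ?_
  have hiff : Z.1 ⊆ Jᶜ ↔ Z.1 ∩ J = ∅ := by
    rw [Finset.subset_compl_iff_disjoint_right, Finset.disjoint_iff_inter_eq_empty]
  simp only [hiff]
  split_ifs with h
  · simp [h]
  · simp [zero_pow (Finset.card_ne_zero.2 (Finset.nonempty_iff_ne_empty.2 h))]

theorem tilde_eq_zero_of_card_lt (f : Layer n d →₀ ℝ) {J : Finset (Fin n)} (hJ : J.card < d) :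
    tilde f J = 0 :=
  Finset.sum_eq_zero fun Z hZ => by
    have := Finset.card_le_card (Finset.mem_filter.1 hZ).2
    have := Z.2
    omega

theorem tilde_eq_zero_of_card_compl_lt (hf : f ∈ Harm n d) {J : Finset (Fin n)}
    (hJ : Jᶜ.card < d) : tilde f J = 0 := by
  rw [← compl_compl J, tilde_compl hf, tilde_eq_zero_of_card_lt f hJ, mul_zero]

/-- For fixed `Z`, the right side is a product of factors attached to single coordinates, so that it
can be summed over `J`. It comes from the previous identity at `a = x - y`, `b = -y`, where `a - b =
x`, after multiplying by `(x - y) ^ d`. -/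
theorem mul_pow_mul_tilde_smul (hf : f ∈ Harm n d) {A : Type*} [CommRing A] [IsDomain A]
    [Algebra ℝ A] {x y : A} (hxy : x - y ≠ 0) (J : Finset (Fin n)) :
    (x * y) ^ d * (tilde f J • (y ^ (J.card - d) * (x - y) ^ (Jᶜ.card - d))) =
      ∑ Z : Layer n d, f Z •
        (y ^ J.card * ((-y) ^ (Jᶜ ∩ Z.1).card * (x - y) ^ (Jᶜ \ Z.1).card)) := by
  classical
  have h := sum_smul_pow_mul_pow hf J (x - y) (-y)
  rw [sub_neg_eq_add, sub_add_cancel] at h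
  have key : (x - y) ^ d * ∑ Z : Layer n d, f Z •
      (y ^ J.card * ((-y) ^ (Jᶜ ∩ Z.1).card * (x - y) ^ (Jᶜ \ Z.1).card)) =
        tilde f J • (y ^ J.card * (x - y) ^ Jᶜ.card * x ^ d) := by
    rw [← mul_smul_comm, ← h, Finset.mul_sum, Finset.mul_sum]
    refine Finset.sum_congr rfl fun Z _ => ?_
    have h1 : Jᶜ ∩ Z.1 = Z.1 \ J := by ext; simp [and_comm]
    have h2 : d + (Jᶜ \ Z.1).card = Jᶜ.card + (Z.1 ∩ J).card := by
      have e1 := Finset.card_inter_add_card_sdiff Z.1 J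
      have e2 := Finset.card_inter_add_card_sdiff Jᶜ Z.1
      have e3 := Z.2
      rw [h1] at e2
      omega
    rw [mul_smul_comm, mul_smul_comm, h1]
    congr 1
    calc _ = y ^ J.card * (-y) ^ (Z.1 \ J).card * (x - y) ^ (d + (Jᶜ \ Z.1).card) := by
          rw [pow_add]; ring
      _ = _ := by rw [h2, pow_add]; ring
  refine mul_left_cancel₀ (pow_ne_zero d hxy) ?_
  rw [key, mul_smul_comm, mul_smul_comm]
  -- Where an exponent is truncated, `tilde f J` vanishes.
  rcases lt_or_ge J.card d with h1 | h1
  · simp [tilde_eq_zero_of_card_lt f h1]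
  rcases lt_or_ge Jᶜ.card d with h2 | h2
  · simp [tilde_eq_zero_of_card_compl_lt hf h2]
  congr 1
  obtain ⟨p, hp⟩ := Nat.exists_eq_add_of_le h1
  obtain ⟨q, hq⟩ := Nat.exists_eq_add_of_le h2
  rw [hp, hq, Nat.add_sub_cancel_left, Nat.add_sub_cancel_left]
  ring

theorem sum_superset_mul_tilde_smul (hf : f ∈ Harm n d) {A : Type*} [CommRing A] [IsDomain A]
    [Algebra ℝ A] {x y : A} (hxy : x - y ≠ 0) (T : Finset (Fin n)) :
    ∑ J with T ⊆ J, (x * y) ^ d *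
        (tilde f J • (y ^ (J.card - d) * (x - y) ^ (Jᶜ.card - d))) =
      tilde f T • (x ^ Tᶜ.card * y ^ T.card) := by
  classical
  simp only [mul_pow_mul_tilde_smul hf hxy]
  rw [Finset.sum_comm, tilde, Finset.sum_filter, Finset.sum_smul]
  refine Finset.sum_congr rfl fun Z _ => ?_
  rw [← Finset.smul_sum, ite_smul, zero_smul, ← smul_zero (f Z), ← smul_ite]
  congr 1
  -- The factor `0` on `T` forces `T ⊆ J`. Coordinates in `T` give `y`, those in `Z \ T` give `y - y
  -- = 0`, the others `x`; hence only `Z ⊆ T` survive.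
  have hprod := Fintype.prod_add (fun _ : Fin n => y)
    (fun i => if i ∈ T then 0 else if i ∈ Z.1 then -y else x - y)
  have hterm (J : Finset (Fin n)) :
      (∏ i ∈ Jᶜ, if i ∈ T then 0 else if i ∈ Z.1 then -y else x - y) =
        if T ⊆ J then (-y) ^ (Jᶜ ∩ Z.1).card * (x - y) ^ (Jᶜ \ Z.1).card else 0 := by
    split_ifs with h
    · rw [Finset.prod_congr rfl (g := fun i => if i ∈ Z.1 then -y else x - y)
        fun i hi => if_neg fun hT => Finset.mem_compl.1 hi (h hT)]
      rw [Finset.prod_ite, Finset.prod_const, Finset.prod_const, Finset.filter_mem_eq_inter,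
        Finset.filter_notMem_eq_sdiff]
    · obtain ⟨i, hi, hJ⟩ := Finset.not_subset.1 h
      exact Finset.prod_eq_zero (Finset.mem_compl.2 hJ) (if_pos hi)
  simp only [hterm, Finset.prod_const, mul_ite, mul_zero] at hprod
  rw [Finset.sum_filter, ← hprod]
  split_ifs with h
  · have hi (i : Fin n) : (y + if i ∈ T then 0 else if i ∈ Z.1 then -y else x - y) =
        if i ∈ T then y else x := by
      by_cases hT : i ∈ T
      · simp [hT]
      · have hZ : i ∉ Z.1 := fun hZ => hT (h hZ)
        simp [hT, hZ]
    simp only [hi]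
    rw [Finset.prod_ite, Finset.prod_const, Finset.prod_const, Finset.filter_mem_eq_inter,
      Finset.filter_notMem_eq_sdiff, Finset.univ_inter, ← Finset.compl_eq_univ_sdiff, mul_comm]
  · obtain ⟨i, hi, hT⟩ := Finset.not_subset.1 h
    exact Finset.prod_eq_zero (Finset.mem_univ i) (by simp [hi, hT])

end Harmonic

/-! ### The weight enumerator -/

/-- A union of supports lies in `J` exactly when each support does, so the tuples are counted by a
power. -/
theorem sum_tupleCount {R : Type*} [Ring R] [Finite R] {n : ℕ} (m : ℕ) (C : Set (Fin n → R))
    (J : Finset (Fin n)) :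
    ∑ T with T ⊆ J, tupleCount m C T = shortenedCard C J ^ m := by
  classical
  let S : (Fin m → C) → Finset (Fin n) := fun u => Finset.univ.biUnion fun i => supp (u i).1
  have e : {u : Fin m → C // S u ⊆ J} ≃ (Fin m → {u : Fin n → R // u ∈ C ∧ supp u ⊆ J}) :=
    { toFun := fun u i => ⟨u.1 i, (u.1 i).2,
        (Finset.biUnion_subset.1 u.2) i (Finset.mem_univ i)⟩
      invFun := fun u => ⟨fun i => ⟨(u i).1, (u i).2.1⟩,
        Finset.biUnion_subset.2 fun i _ => (u i).2.2⟩
      left_inv := fun _ => rfl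
      right_inv := fun _ => rfl }
  have h1 : shortenedCard C J ^ m = Nat.card {u : Fin m → C // S u ⊆ J} := by
    rw [Nat.card_congr e, Nat.card_fun, Nat.card_fin, shortenedCard]
  have := Fintype.ofFinite C
  rw [h1, Nat.card_eq_fintype_card, Fintype.card_subtype,
    Finset.card_eq_sum_card_fiberwise (f := S) (t := Finset.univ.filter (· ⊆ J))
      fun u hu => by simpa using hu]
  refine Finset.sum_congr rfl fun T hT => ?_
  rw [tupleCount, Nat.card_eq_fintype_card, Fintype.card_subtype, Finset.filter_filter]
  congr 1
  ext u
  simp only [Finset.mem_filter, Finset.mem_univ, true_and]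
  exact ⟨fun h => ⟨(show S u = T from h) ▸ (Finset.mem_filter.1 hT).2, h⟩, fun h => h.2⟩

open MvPolynomial

/-- The quotient of the harmonic weight enumerator by `(x y) ^ d`. -/
noncomputable def reducedEnumerator {R : Type*} [Ring R] {n d : ℕ} (m : ℕ) (C : Set (Fin n → R))
    (f : Layer n d →₀ ℝ) : MvPolynomial (Fin 2) ℝ :=
  ∑ J : Finset (Fin n), ((shortenedCard C J : ℝ) ^ m * tilde f J) •
    (X 1 ^ (J.card - d) * (X 0 - X 1) ^ (Jᶜ.card - d))

theorem X_zero_sub_X_one_ne_zero : (X 0 - X 1 : MvPolynomial (Fin 2) ℝ) ≠ 0 :=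
  sub_ne_zero.2 fun h => zero_ne_one (X_injective h)

theorem harmonicWeightEnumerator_eq {R : Type*} [Ring R] [Finite R] {n d : ℕ} (m : ℕ)
    (C : Set (Fin n → R)) {f : Layer n d →₀ ℝ} (hf : f ∈ Harm n d) :
    harmonicWeightEnumerator m C f = (X 0 * X 1) ^ d * reducedEnumerator m C f := by
  classical
  have hterm (T : Finset (Fin n)) :
      (MvPolynomial.C (tilde f T * (tupleCount m C T : ℝ)) * X 0 ^ Tᶜ.card * X 1 ^ T.card :
          MvPolynomial (Fin 2) ℝ) =
        ∑ J with T ⊆ J, (tupleCount m C T : ℝ) • ((X 0 * X 1) ^ d *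
          (tilde f J • (X 1 ^ (J.card - d) * (X 0 - X 1) ^ (Jᶜ.card - d)))) := by
    have h := sum_superset_mul_tilde_smul hf X_zero_sub_X_one_ne_zero T
    rw [← Finset.smul_sum, h, smul_smul, mul_assoc, ← smul_eq_C_mul, mul_comm (tilde f T)]
  rw [harmonicWeightEnumerator]
  refine (Finset.sum_congr rfl fun T _ => hterm T).trans ?_
  rw [Finset.sum_comm' (t' := Finset.univ) (s' := fun J => Finset.univ.filter (· ⊆ J))
    (by simp), reducedEnumerator, Finset.mul_sum]
  refine Finset.sum_congr rfl fun J _ => ?_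
  have h : ∑ T with T ⊆ J, (tupleCount m C T : ℝ) = (shortenedCard C J : ℝ) ^ m := by
    exact_mod_cast sum_tupleCount m C J
  rw [← Finset.sum_smul, h, mul_smul, mul_smul_comm, mul_smul_comm, mul_smul_comm]

theorem reducedEnumerator_isHomogeneous {R : Type*} [Ring R] {n d : ℕ} (m : ℕ)
    (C : Set (Fin n → R)) {f : Layer n d →₀ ℝ} (hf : f ∈ Harm n d) :
    (reducedEnumerator m C f).IsHomogeneous (n - 2 * d) := by
  refine IsHomogeneous.sum _ _ _ fun J _ => ?_
  rcases lt_or_ge J.card d with h1 | h1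
  · simpa [tilde_eq_zero_of_card_lt f h1] using isHomogeneous_zero _ _ _
  rcases lt_or_ge Jᶜ.card d with h2 | h2
  · simpa [tilde_eq_zero_of_card_compl_lt hf h2] using isHomogeneous_zero _ _ _
  have h3 := Finset.card_add_card_compl J
  rw [Fintype.card_fin] at h3
  rw [smul_eq_C_mul]
  refine IsHomogeneous.C_mul ?_ _
  rw [show n - 2 * d = 1 * (J.card - d) + 1 * (Jᶜ.card - d) by omega]
  exact ((isHomogeneous_X ℝ 1).pow _).mul
    (((isHomogeneous_X ℝ 0).sub (isHomogeneous_X ℝ 1)).pow _)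

theorem reducedEnumerator_eq_zero {R : Type*} [Ring R] {n d : ℕ} (m : ℕ)
    (C : Set (Fin n → R)) {f : Layer n d →₀ ℝ} (hf : f ∈ Harm n d) (h : n < 2 * d) :
    reducedEnumerator m C f = 0 := by
  refine Finset.sum_eq_zero fun J _ => ?_
  have h3 := Finset.card_add_card_compl J
  rw [Fintype.card_fin] at h3
  rcases lt_or_ge J.card d with h1 | h1
  · simp [tilde_eq_zero_of_card_lt f h1]
  · simp [tilde_eq_zero_of_card_compl_lt hf (show Jᶜ.card < d by omega)]

theorem reducedEnumerator_rightDual {R : Type*} [Ring R] [Finite R] (hR : IsFrobeniusRing R)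
    {n d : ℕ} (m : ℕ) (D : Submodule R (Fin n → R)) {f : Layer n d →₀ ℝ} (hf : f ∈ Harm n d) :
    reducedEnumerator m (rightDual D : Set (Fin n → R)) f =
      C ((-1 : ℝ) ^ d * (((Nat.card R : ℝ) ^ m) ^ d / (Nat.card D : ℝ) ^ m)) *
        aeval ![X 0 + C ((Nat.card R : ℝ) ^ m - 1) * X 1, X 0 - X 1]
          (reducedEnumerator m (D : Set (Fin n → R)) f) := by
  classical
  rw [← smul_eq_C_mul]
  set q : ℝ := (Nat.card R : ℝ) ^ m with hq
  simp only [reducedEnumerator, map_sum, map_smul, map_mul, map_pow, map_sub (aeval _), aeval_X,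
    Matrix.cons_val_zero, Matrix.cons_val_one]
  rw [Finset.smul_sum, ← Equiv.sum_comp (Function.Involutive.toPerm compl compl_involutive)]
  refine Finset.sum_congr rfl fun J _ => ?_
  have hsub : (X 0 + C (q - 1) * X 1 - (X 0 - X 1) : MvPolynomial (Fin 2) ℝ) =
      C q * X 1 := by
    rw [C_sub, C_1]; ring
  rw [hsub, Function.Involutive.coe_toPerm, compl_compl, tilde_compl hf]
  rcases lt_or_ge Jᶜ.card d with h2 | h2
  · simp [tilde_eq_zero_of_card_compl_lt hf h2]
  obtain ⟨k, hk⟩ := Nat.exists_eq_add_of_le h2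
  -- With `|Jᶜ| = d + k`, the dual count contributes `q ^ (d + k)` and the substitution `q ^ k`; the
  -- quotient is the factor `q ^ d`.
  have hD : (Nat.card D : ℝ) ≠ 0 := by exact_mod_cast Nat.card_pos.ne'
  have hcard : (shortenedCard (rightDual D : Set (Fin n → R)) Jᶜ : ℝ) =
      (Nat.card R : ℝ) ^ (d + k) * shortenedCard (D : Set (Fin n → R)) J / Nat.card D := by
    rw [eq_div_iff hD, mul_comm]
    have h := card_mul_shortenedCard_rightDual hR D Jᶜ
    rw [compl_compl, hk] at h
    exact_mod_cast h
  rw [hcard, hk, Nat.add_sub_cancel_left, mul_pow (C _), ← C_pow, ← smul_eq_C_mul,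
    mul_smul_comm, smul_smul, smul_smul, mul_comm (X 1 ^ k)]
  congr 1
  rw [hq, div_pow, mul_pow, pow_add]
  field_simp
  ring

end HarmonicCodes

open HarmonicCodes MvPolynomial in
/-- The quotients `Z` and `Z'` (for `C` and for its dual) are determined by the first two
equations, as the polynomial ring is a domain. In the degree `n - 2d` the subtraction is
truncated; for `n < 2d` the claim is that the quotients vanish. -/
theorem theorem3p2 {R : Type*} [Ring R] [Finite R] (hR : IsFrobeniusRing R) (m n d : ℕ)
    (D : Submodule R (Fin n → R)) (f : Layer n d →₀ ℝ) (hf : f ∈ Harm n d) :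
    ∃ Z Z' : MvPolynomial (Fin 2) ℝ,
      harmonicWeightEnumerator m (D : Set (Fin n → R)) f = (X 0 * X 1) ^ d * Z ∧
      harmonicWeightEnumerator m (rightDual D : Set (Fin n → R)) f = (X 0 * X 1) ^ d * Z' ∧
      Z.IsHomogeneous (n - 2 * d) ∧
      Z'.IsHomogeneous (n - 2 * d) ∧
      (n < 2 * d → Z = 0 ∧ Z' = 0) ∧
      Z' = C ((-1 : ℝ) ^ d * (((Nat.card R : ℝ) ^ m) ^ d / (Nat.card D : ℝ) ^ m)) *
        aeval ![X 0 + C ((Nat.card R : ℝ) ^ m - 1) * X 1, X 0 - X 1] Z := by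
  have h := reducedEnumerator_rightDual hR m D hf
  exact ⟨_, _, harmonicWeightEnumerator_eq m _ hf, harmonicWeightEnumerator_eq m _ hf,
    reducedEnumerator_isHomogeneous m _ hf, reducedEnumerator_isHomogeneous m _ hf,
    fun hn => ⟨reducedEnumerator_eq_zero m _ hf hn, reducedEnumerator_eq_zero m _ hf hn⟩, h⟩
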